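/- For positive integers $s_1,\dots,s_d$ and signs $z_1,\dots,z_d\in\{\pm1\}$ with $(s_1,z_1)\ne(1,1)$, let $$\zeta(s_1,\dots,s_d;z_1,\dots,z_d)=\lim_{M\to\infty}\ \sum_{M\ge n_1>\cdots>n_d>0}\frac{z_1^{n_1}\cdots z_d^{n_d}}{n_1^{s_1}\cdots n_d^{s_d}}$$ be the Euler sum (this limit exists); the signs are omitted from the notation and a bar is put over $s_j$ when $z_j=-1$. Let $w\ge 4$ be an integer, $u=w-2$, $v=w-1$, and let $\sum'$ denote the sum over all positive integers $a,b$ with $a+b=w-1$ and $a\ge2$. Then \begin{align*} \sum{}' \zeta(a,b,1)&=\zeta(v,1)+\zeta(u,2),\\ \sum{}' \zeta(a,\bar b,1)&=\zeta(\bar v,1)+\zeta(\bar u,2)+2\zeta(\bar u,1,1)-\zeta(\bar u,\bar1,\bar1)-\zeta(\bar u,1,\bar1),\\ \sum{}' \zeta(\bar a,b,1)&=\zeta(v,1)+\zeta(\bar u,\bar2)+\zeta(\bar u,1,\bar1)+\zeta(\bar u,\bar1,1)+\zeta(\bar1,\bar u,1)-2\zeta(\bar u,1,1)-\zeta(\bar1,u,1),\\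 \sum{}' \zeta(\bar a,\bar b,1)&=\zeta(\bar v,1)+\zeta(u,\bar2)+\zeta(u,\bar1,1)+\zeta(\bar1,u,1)-\zeta(u,\bar1,\bar1)-\zeta(\bar1,\bar u,1),\\ \sum{}' \zeta(\bar a,\bar b,\bar1)&=\zeta(\bar v,\bar1)+\zeta(u,2)+2\zeta(u,\bar1,\bar1)+\zeta(\bar1,u,\bar1)-2\zeta(u,\bar1,1)-\zeta(\bar1,\bar u,\bar1),\\ \sum{}' \zeta(a,b,\bar1)&=\zeta(v,\bar1)+\zeta(u,\bar2)+\zeta(u,\bar1,1)-\zeta(u,\bar1,\bar1),\\ \sum{}' \zeta(a,\bar b,\bar1)&=\zeta(\bar v,\bar1)+\zeta(\bar u,\bar2)+\zeta(\bar u,1,\bar1)-\zeta(\bar u,\bar1,1),\\ \sum{}' \zeta(\bar a,b,\bar1)&=\zeta(v,\bar1)+\zeta(\bar u,2)+\zeta(\bar u,\bar1,\bar1)+\zeta(\bar1,\bar u,\bar1)-\zeta(\bar u,1,\bar1)-\zeta(\bar1,u,\bar1). \end{align*} -/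

import Mathlib

/-- An entry `(s, z)` of an Euler sum: an exponent `s` together with a sign `z = ±1`.
`plain s` is the entry `s` (sign `+1`). -/
abbrev plain (s : ℕ) : ℕ × ℤˣ := (s, 1)

/-- `bar s` is the barred entry, i.e. the exponent `s` with sign `-1`. -/
abbrev bar (s : ℕ) : ℕ × ℤˣ := (s, -1)

/-- The truncated Euler sum
`∑_{M ≥ n₁ > ⋯ > n_d > 0} z₁ ^ n₁ ⋯ z_d ^ n_d / (n₁ ^ s₁ ⋯ n_d ^ s_d)`,
written as an iterated sum with the outermost index `n₁` first (it is `1` in depth `0`). -/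
noncomputable def truncEulerSum : List (ℕ × ℤˣ) → ℕ → ℝ
  | [], _ => 1
  | (s, z) :: t, M =>
      ∑ n ∈ Finset.Icc 1 M, (((z : ℤ) : ℝ) ^ n / (n : ℝ) ^ s) * truncEulerSum t (n - 1)

/-- The Euler sum: the limit of the truncated sums as `M → ∞`. -/
noncomputable def eulerSum (l : List (ℕ × ℤˣ)) : ℝ :=
  Filter.limUnder Filter.atTop (truncEulerSum l)

/-- All exponents are positive, and the first entry exists and is not `(1, +1)`. -/
def AdmissibleIndex : List (ℕ × ℤˣ) → Prop
  | [] => False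
  | p :: t => p ≠ plain 1 ∧ ∀ q ∈ p :: t, 1 ≤ q.1

/-- `∑_{a + b = n, a ≥ 2, b ≥ 1} F a b`. -/
def restrictedSum (n : ℕ) (F : ℕ → ℕ → ℝ) : ℝ :=
  ∑ p ∈ (Finset.HasAntidiagonal.antidiagonal n).filter (fun p => 2 ≤ p.1 ∧ 1 ≤ p.2), F p.1 p.2

/-! Fix signs `α`, `β`, `γ` and indices `n > m`. The sum of `1 / (n ^ a * m ^ b)` over the allowed
`a`, `b` is geometric, and splits into terms with `1 / (m ^ u * (n - m))`, `1 / (n * m ^ u)` and `1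
/ (n ^ u * (n - m))`. After summation over `n` and `m`: the second is a truncated Euler sum; the
third is a convolution, evaluated by the shuffle product (`sum_eulerTerm_mul_truncEulerSum_sub`);
the first, with `k = n - m`, is almost the product of the sums of `[(1, α)]` and `[(u, α * β), (1,
γ)]`, except that `k` runs up to `M - m` instead of `M`. The true product is expanded by the stuffle
rule (`truncEulerSum_mul_depth_two`), and the discrepancy tends to 0 by dominated convergence
(`tendsto_sum_eulerTerm_mul_sub`).

Everything is done at finite `M` because for `α = 1` the sums with leading entry `(1, α)` need not
converge; they occur only in a difference, which then vanishes identically. For `α = -1` both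
converge. The eight formulas are the eight choices of signs. -/

open Filter Topology

/-- The summand `z ^ n / n ^ s` attached to an entry `(s, z)`. -/
noncomputable def eulerTerm (p : ℕ × ℤˣ) (n : ℕ) : ℝ := ((p.2 : ℤ) : ℝ) ^ n / (n : ℝ) ^ p.1

theorem truncEulerSum_nil (M : ℕ) : truncEulerSum [] M = 1 := rfl

theorem truncEulerSum_cons (p : ℕ × ℤˣ) (t : List (ℕ × ℤˣ)) (M : ℕ) :
    truncEulerSum (p :: t) M
      = ∑ n ∈ Finset.Icc 1 M, eulerTerm p n * truncEulerSum t (n - 1) := rfl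

theorem truncEulerSum_singleton (p : ℕ × ℤˣ) (M : ℕ) :
    truncEulerSum [p] M = ∑ n ∈ Finset.Icc 1 M, eulerTerm p n := by
  simp [truncEulerSum_cons, truncEulerSum_nil]

@[simp] theorem truncEulerSum_cons_zero (p : ℕ × ℤˣ) (t : List (ℕ × ℤˣ)) :
    truncEulerSum (p :: t) 0 = 0 := by
  simp [truncEulerSum_cons]

theorem truncEulerSum_cons_succ (p : ℕ × ℤˣ) (t : List (ℕ × ℤˣ)) (M : ℕ) :
    truncEulerSum (p :: t) (M + 1)
      = truncEulerSum (p :: t) M + eulerTerm p (M + 1) * truncEulerSum t M := by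
  rw [truncEulerSum_cons, Finset.sum_Icc_succ_top (by omega), ← truncEulerSum_cons]
  simp

theorem units_cast_mul_self (z : ℤˣ) : ((z : ℤ) : ℝ) * ((z : ℤ) : ℝ) = 1 := by
  rcases Int.units_eq_one_or z with h | h <;> simp [h]

theorem abs_sign_pow (z : ℤˣ) (n : ℕ) : |((z : ℤ) : ℝ) ^ n| = 1 := by
  rcases Int.units_eq_one_or z with h | h <;> simp [h]

theorem sign_pow_sub (z : ℤˣ) {m n : ℕ} (h : m ≤ n) :
    ((z : ℤ) : ℝ) ^ (n - m) = ((z : ℤ) : ℝ) ^ n * ((z : ℤ) : ℝ) ^ m := by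
  obtain ⟨k, rfl⟩ := Nat.exists_eq_add_of_le h
  have : ((z : ℤ) : ℝ) ^ m * ((z : ℤ) : ℝ) ^ m = 1 := by
    rw [← mul_pow, units_cast_mul_self, one_pow]
  rw [Nat.add_sub_cancel_left, pow_add]
  linear_combination (-((z : ℤ) : ℝ) ^ k) * this

theorem abs_eulerTerm (p : ℕ × ℤˣ) (n : ℕ) : |eulerTerm p n| = 1 / (n : ℝ) ^ p.1 := by
  rw [eulerTerm, abs_div, abs_sign_pow, abs_of_nonneg (by positivity)]

theorem abs_eulerTerm_le (p : ℕ × ℤˣ) (k : ℕ) (hp : k ≤ p.1) (n : ℕ) :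
    |eulerTerm p (n + 1)| ≤ 1 / ((n + 1 : ℕ) : ℝ) ^ k := by
  rw [abs_eulerTerm]
  apply one_div_le_one_div_of_le (by positivity)
  exact pow_le_pow_right₀ (by exact_mod_cast Nat.succ_le_succ (Nat.zero_le n)) hp

theorem eulerTerm_mul (s t : ℕ) (y z : ℤˣ) (n : ℕ) :
    eulerTerm (s, y) n * eulerTerm (t, z) n = eulerTerm (s + t, y * z) n := by
  simp only [eulerTerm, Units.val_mul, Int.cast_mul, mul_pow, pow_add]
  rw [div_mul_div_comm]

/-! ### Growth of truncated sums -/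

theorem harmonic_real_succ (n : ℕ) :
    (harmonic (n + 1) : ℝ) = harmonic n + 1 / ((n + 1 : ℕ) : ℝ) := by
  rw [harmonic_succ]; push_cast; rw [one_div]

theorem harmonic_real_nonneg (n : ℕ) : (0 : ℝ) ≤ harmonic n := by
  induction n with
  | zero => simp
  | succ n ih => rw [harmonic_real_succ]; positivity

theorem harmonic_real_mono : Monotone fun n : ℕ => (harmonic n : ℝ) := by
  refine monotone_nat_of_le_succ fun n => ?_
  rw [harmonic_real_succ]
  have : (0 : ℝ) ≤ 1 / ((n + 1 : ℕ) : ℝ) := by positivity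
  linarith

theorem abs_truncEulerSum_le (l : List (ℕ × ℤˣ)) (hl : ∀ q ∈ l, 1 ≤ q.1) (M : ℕ) :
    |truncEulerSum l M| ≤ (harmonic M : ℝ) ^ l.length := by
  induction l generalizing M with
  | nil => simp [truncEulerSum_nil]
  | cons p t ih =>
    have ih := ih fun q hq => hl q (List.mem_cons_of_mem _ hq)
    induction M with
    | zero => simp
    | succ M ihM =>
      rw [truncEulerSum_cons_succ]
      have hmono := harmonic_real_mono (Nat.le_succ M)
      have h0 := harmonic_real_nonneg M
      have h1 : |eulerTerm p (M + 1) * truncEulerSum t M|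
          ≤ 1 / ((M + 1 : ℕ) : ℝ) * (harmonic (M + 1) : ℝ) ^ t.length := by
        rw [abs_mul]
        have := abs_eulerTerm_le p 1 (hl p List.mem_cons_self) M
        rw [pow_one] at this
        exact mul_le_mul this ((ih M).trans (pow_le_pow_left₀ h0 hmono _)) (abs_nonneg _)
          (by positivity)
      have h2 : (harmonic M : ℝ) ^ (t.length + 1)
          ≤ harmonic M * (harmonic (M + 1) : ℝ) ^ t.length := by
        rw [pow_succ']
        exact mul_le_mul_of_nonneg_left (pow_le_pow_left₀ h0 hmono _) h0
      calc _ ≤ _ := abs_add_le _ _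
        _ ≤ _ := add_le_add (ihM.trans h2) h1
        _ = (harmonic (M + 1) : ℝ) ^ (t.length + 1) := by
          rw [pow_succ', ← add_mul, ← harmonic_real_succ]

theorem harmonic_pow_isLittleO (d : ℕ) {r : ℝ} (hr : 0 < r) :
    (fun n : ℕ => (harmonic n : ℝ) ^ d) =o[atTop] fun n : ℕ => (n : ℝ) ^ r := by
  have h1 : (fun n : ℕ => (harmonic n : ℝ)) =O[atTop] fun n : ℕ => Real.log n := by
    refine Asymptotics.IsBigO.of_bound 2 ?_
    filter_upwards [(Real.tendsto_log_atTop.comp tendsto_natCast_atTop_atTop).eventually_ge_atTop 1]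
      with n hn
    simp only [Function.comp_apply] at hn
    rw [Real.norm_of_nonneg (harmonic_real_nonneg n), Real.norm_of_nonneg (by linarith)]
    linarith [harmonic_le_one_add_log n]
  refine (h1.pow d).trans_isLittleO ?_
  have := isLittleO_log_rpow_rpow_atTop (d : ℝ) hr
  simp only [Real.rpow_natCast] at this
  exact this.comp_tendsto tendsto_natCast_atTop_atTop

theorem summable_harmonic_pow_div_sq (d : ℕ) :
    Summable fun n : ℕ => (harmonic n : ℝ) ^ d / (n : ℝ) ^ 2 := by
  have h := ((harmonic_pow_isLittleO d (r := 1 / 2) (by norm_num)).isBigO).mul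
    (Asymptotics.isBigO_refl (fun n : ℕ => ((n : ℝ) ^ 2)⁻¹) atTop)
  -- The exponent 3/2 is 2 - 1/2: half a power of `n` absorbs the harmonic factor.
  refine summable_of_isBigO_nat (Real.summable_nat_rpow_inv.2 (by norm_num : (1 : ℝ) < 3 / 2)) ?_
  simp only [div_eq_mul_inv]
  refine h.trans (Asymptotics.IsBigO.of_bound 1 ?_)
  filter_upwards [eventually_gt_atTop 0] with n hn
  have hn : (0 : ℝ) < n := by exact_mod_cast hn
  rw [one_mul, ← Real.rpow_natCast, ← Real.rpow_neg hn.le, ← Real.rpow_neg hn.le,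
    ← Real.rpow_add hn]
  norm_num

theorem tendsto_harmonic_pow_div (d : ℕ) :
    Tendsto (fun n : ℕ => (harmonic n : ℝ) ^ d / (n : ℝ)) atTop (𝓝 0) := by
  have := (harmonic_pow_isLittleO d one_pos).tendsto_div_nhds_zero
  simpa using this

/-! ### Convergence of Euler sums -/

theorem sum_Icc_one_eq_sum_range (f : ℕ → ℝ) (M : ℕ) :
    ∑ n ∈ Finset.Icc 1 M, f n = ∑ n ∈ Finset.range M, f (n + 1) := by
  induction M with
  | zero => simp
  | succ M ih => rw [Finset.sum_Icc_succ_top (by omega), Finset.sum_range_succ, ih]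

theorem exists_tendsto_truncEulerSum_of_two_le (p : ℕ × ℤˣ) (t : List (ℕ × ℤˣ)) (hp : 2 ≤ p.1)
    (ht : ∀ q ∈ t, 1 ≤ q.1) : ∃ L, Tendsto (truncEulerSum (p :: t)) atTop (𝓝 L) := by
  have hs : Summable fun n : ℕ => eulerTerm p (n + 1) * truncEulerSum t n := by
    refine Summable.of_norm_bounded
      ((summable_nat_add_iff 1).2 (summable_harmonic_pow_div_sq t.length)) fun n => ?_
    rw [Real.norm_eq_abs, abs_mul, div_eq_mul_one_div, mul_comm]
    exact mul_le_mul ((abs_truncEulerSum_le t ht n).trans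
      (pow_le_pow_left₀ (harmonic_real_nonneg n) (harmonic_real_mono (Nat.le_succ n)) _))
      (abs_eulerTerm_le p 2 hp n) (abs_nonneg _)
      (pow_nonneg (harmonic_real_nonneg _) _)
  refine ⟨_, hs.hasSum.tendsto_sum_nat.congr fun M => ?_⟩
  rw [truncEulerSum_cons, sum_Icc_one_eq_sum_range]
  simp

/-- Summation by parts: twice the partial sum is the alternating sum of the differences plus `f 0 -
(-1) ^ M * f M`. -/
theorem exists_tendsto_alternating_sum {f : ℕ → ℝ} (hf : Tendsto f atTop (𝓝 0))
    (hs : Summable fun n => |f n - f (n + 1)|) :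
    ∃ L, Tendsto (fun M => ∑ n ∈ Finset.range M, (-1 : ℝ) ^ n * f n) atTop (𝓝 L) := by
  have hs' : Summable fun n => (-1 : ℝ) ^ n * (f n - f (n + 1)) := by
    refine Summable.of_norm_bounded hs fun n => ?_
    simp
  have hb : Tendsto (fun M => (-1 : ℝ) ^ M * f M) atTop (𝓝 0) := by
    refine squeeze_zero_norm (fun M => ?_) (tendsto_norm_zero.comp hf)
    simp
  refine ⟨_, ((hs'.hasSum.tendsto_sum_nat.add_const (f 0)).sub hb |>.div_const 2).congr
    fun M => ?_⟩
  induction M with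
  | zero => simp
  | succ M ih =>
    rw [Finset.sum_range_succ, Finset.sum_range_succ, ← ih, pow_succ]
    ring

theorem exists_tendsto_truncEulerSum_bar_one (t : List (ℕ × ℤˣ)) (ht : ∀ q ∈ t, 1 ≤ q.1) :
    ∃ L, Tendsto (truncEulerSum (bar 1 :: t)) atTop (𝓝 L) := by
  suffices h : ∃ L, Tendsto (fun M => ∑ n ∈ Finset.range M,
      (-1 : ℝ) ^ n * (truncEulerSum t n / ((n + 1 : ℕ) : ℝ))) atTop (𝓝 L) by
    obtain ⟨L, hL⟩ := h
    refine ⟨_, hL.neg.congr fun M => ?_⟩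
    rw [truncEulerSum_cons, sum_Icc_one_eq_sum_range, ← Finset.sum_neg_distrib]
    refine Finset.sum_congr rfl fun n _ => ?_
    simp [eulerTerm, pow_succ]
    ring
  apply exists_tendsto_alternating_sum
  · refine squeeze_zero_norm (fun n => ?_)
      ((tendsto_add_atTop_iff_nat 1).2 (tendsto_harmonic_pow_div t.length))
    rw [Real.norm_eq_abs, abs_div, Nat.abs_cast]
    gcongr
    exact (abs_truncEulerSum_le t ht n).trans
      (pow_le_pow_left₀ (harmonic_real_nonneg n) (harmonic_real_mono (Nat.le_succ n)) _)
  · have hdiff : ∀ n, |truncEulerSum t (n + 1) - truncEulerSum t n|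
        ≤ (harmonic (n + 1) : ℝ) ^ t.length / ((n + 1 : ℕ) : ℝ) := by
      intro n
      cases t with
      | nil =>
        simp only [truncEulerSum_nil, sub_self, abs_zero]
        have := harmonic_real_nonneg (n + 1)
        positivity
      | cons p t =>
        rw [truncEulerSum_cons_succ, add_sub_cancel_left, abs_mul, div_eq_mul_one_div, mul_comm]
        have h1 := abs_eulerTerm_le p 1 (ht p List.mem_cons_self) n
        rw [pow_one] at h1
        refine mul_le_mul ?_ h1 (abs_nonneg _) (pow_nonneg (harmonic_real_nonneg _) _)
        -- The inner tail has depth one less, so the exponent must be raised by one.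
        have hone : (1 : ℝ) ≤ harmonic (n + 1) := by
          have := harmonic_real_mono (Nat.succ_le_succ (Nat.zero_le n))
          simpa using this
        refine (abs_truncEulerSum_le t (fun q hq => ht q (List.mem_cons_of_mem _ hq)) n).trans ?_
        refine (pow_le_pow_left₀ (harmonic_real_nonneg n)
          (harmonic_real_mono (Nat.le_succ n)) _).trans ?_
        exact pow_le_pow_right₀ hone (by simp)
    refine Summable.of_nonneg_of_le (fun _ => abs_nonneg _) (fun n => ?_)
      (((summable_nat_add_iff 1).2 (summable_harmonic_pow_div_sq t.length)).mul_left 2)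
    have hb := (abs_truncEulerSum_le t ht n).trans
      (pow_le_pow_left₀ (harmonic_real_nonneg n) (harmonic_real_mono (Nat.le_succ n)) _)
    have hx : (0 : ℝ) < ((n + 1 : ℕ) : ℝ) := by positivity
    have hy : ((n + 1 + 1 : ℕ) : ℝ) = ((n + 1 : ℕ) : ℝ) + 1 := by push_cast; ring
    have hd := hdiff n
    rw [hy]
    generalize ((n + 1 : ℕ) : ℝ) = x at *
    generalize (harmonic (n + 1) : ℝ) ^ t.length = K at *
    have hK : 0 ≤ K := (abs_nonneg _).trans hb
    -- Discrete product rule: the change of the denominator and that of the numerator are bounded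
    -- separately.
    have e : truncEulerSum t n / x - truncEulerSum t (n + 1) / (x + 1)
        = truncEulerSum t n * (1 / (x * (x + 1)))
          + -((truncEulerSum t (n + 1) - truncEulerSum t n) * (1 / (x + 1))) := by
      field_simp
      ring
    rw [e]
    refine (abs_add_le _ _).trans ?_
    rw [abs_neg, abs_mul, abs_mul, abs_of_nonneg (by positivity : 0 ≤ 1 / (x * (x + 1))),
      abs_of_nonneg (by positivity : 0 ≤ 1 / (x + 1))]
    have i1 : 1 / (x * (x + 1)) ≤ 1 / x ^ 2 :=
      one_div_le_one_div_of_le (by positivity) (by nlinarith)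
    have i2 : 1 / (x + 1) ≤ 1 / x := one_div_le_one_div_of_le hx (by linarith)
    have j1 := mul_le_mul hb i1 (by positivity) hK
    have j2 := mul_le_mul hd i2 (by positivity) (by positivity)
    calc _ ≤ _ := add_le_add j1 j2
      _ = 2 * (K / x ^ 2) := by field_simp; ring

theorem tendsto_truncEulerSum {l : List (ℕ × ℤˣ)} (hl : AdmissibleIndex l) :
    Tendsto (truncEulerSum l) atTop (𝓝 (eulerSum l)) := by
  refine tendsto_nhds_limUnder ?_
  match l, hl with
  | (s, z) :: t, ⟨hne, hpos⟩ =>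
    have ht : ∀ q ∈ t, 1 ≤ q.1 := fun q hq => hpos q (List.mem_cons_of_mem _ hq)
    have hs : 1 ≤ s := hpos (s, z) List.mem_cons_self
    rcases hs.eq_or_lt with rfl | hs
    · rcases Int.units_eq_one_or z with rfl | rfl
      · exact absurd rfl hne
      · exact exists_tendsto_truncEulerSum_bar_one t ht
    · exact exists_tendsto_truncEulerSum_of_two_le _ t hs ht

/-! ### Products of truncated sums -/

theorem truncEulerSum_mul_depth_one (p q : ℕ × ℤˣ) (M : ℕ) :
    truncEulerSum [p] M * truncEulerSum [q] M
      = truncEulerSum [p, q] M + truncEulerSum [(p.1 + q.1, p.2 * q.2)] M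
        + truncEulerSum [q, p] M := by
  induction M with
  | zero => simp
  | succ M ih =>
    simp only [truncEulerSum_cons_succ, truncEulerSum_nil, ← eulerTerm_mul]
    linear_combination ih

/-- Stuffle product: the index of `p` lies above, between or below the indices of `q` and `r`, or
equals one of them. -/
theorem truncEulerSum_mul_depth_two (p q r : ℕ × ℤˣ) (M : ℕ) :
    truncEulerSum [p] M * truncEulerSum [q, r] M
      = truncEulerSum [p, q, r] M + truncEulerSum [(p.1 + q.1, p.2 * q.2), r] M
        + truncEulerSum [q, p, r] M + truncEulerSum [q, (p.1 + r.1, p.2 * r.2)] M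
        + truncEulerSum [q, r, p] M := by
  induction M with
  | zero => simp
  | succ M ih =>
    have h := truncEulerSum_mul_depth_one p r M
    simp only [truncEulerSum_cons_succ p, truncEulerSum_cons_succ q, truncEulerSum_cons_succ (_, _),
      truncEulerSum_nil, ← eulerTerm_mul] at h ⊢
    linear_combination ih + eulerTerm q (M + 1) * h

/-- The shuffle product of two depth one sums, at the level of truncated sums. -/
theorem sum_eulerTerm_mul_truncEulerSum_sub (y z : ℤˣ) (N : ℕ) :
    ∑ p ∈ Finset.Icc 1 N, eulerTerm (1, y) p * truncEulerSum [(1, z)] (N - p)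
      = truncEulerSum [(1, z), (1, y * z)] N + truncEulerSum [(1, y), (1, y * z)] N := by
  induction N with
  | zero => simp
  | succ N ih =>
    have hstep : ∀ p ∈ Finset.Icc 1 N,
        eulerTerm (1, y) p * truncEulerSum [(1, z)] (N + 1 - p)
          = eulerTerm (1, y) p * truncEulerSum [(1, z)] (N - p)
            + (eulerTerm (1, z) (N + 1) * eulerTerm (1, y * z) p
              + eulerTerm (1, y) (N + 1) * eulerTerm (1, y * z) (N + 1 - p)) := by
      intro p hp
      obtain ⟨hp1, hp2⟩ := Finset.mem_Icc.1 hp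
      obtain ⟨k, rfl⟩ := Nat.exists_eq_add_of_le hp2
      have e1 : p + k + 1 - p = k + 1 := by omega
      have e2 : p + k - p = k := by omega
      rw [e1, e2, truncEulerSum_cons_succ, truncEulerSum_nil]
      have hp0 : (p : ℝ) ≠ 0 := by positivity
      have hy : ((y : ℤ) : ℝ) ^ (k + 1) * ((y : ℤ) : ℝ) ^ (k + 1) = 1 := by
        rw [← mul_pow, units_cast_mul_self, one_pow]
      have hz : ((z : ℤ) : ℝ) ^ p * ((z : ℤ) : ℝ) ^ p = 1 := by
        rw [← mul_pow, units_cast_mul_self, one_pow]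
      simp only [eulerTerm, Units.val_mul, Int.cast_mul, mul_pow, pow_one,
        show p + k + 1 = p + (k + 1) by omega, pow_add _ p (k + 1)]
      generalize ((y : ℤ) : ℝ) ^ (k + 1) = a at *
      generalize ((z : ℤ) : ℝ) ^ (k + 1) = b at *
      generalize ((y : ℤ) : ℝ) ^ p = c at *
      generalize ((z : ℤ) : ℝ) ^ p = d at *
      have hk0 : ((k + 1 : ℕ) : ℝ) ≠ 0 := by positivity
      have hpk : (p : ℝ) + ((k + 1 : ℕ) : ℝ) ≠ 0 := by positivity
      rw [Nat.cast_add p (k + 1)]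
      generalize ((k + 1 : ℕ) : ℝ) = K at *
      -- Partial fractions: `1 / (p * K) = (1 / p + 1 / K) / (p + K)`; the squared signs cancel.
      have e3 : d * b / (p + K) * (c * d / p) + c * a / (p + K) * (a * b / K)
          = b * c / (p + K) * (1 / p + 1 / K) := by
        linear_combination b * c / (p + K) / p * hz + b * c / (p + K) / K * hy
      rw [e3]
      field_simp
      ring
    rw [Finset.sum_Icc_succ_top (by omega), Nat.sub_self, truncEulerSum_cons_zero, mul_zero,
      add_zero, Finset.sum_congr rfl hstep, Finset.sum_add_distrib, Finset.sum_add_distrib, ih,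
      ← Finset.mul_sum, ← Finset.mul_sum, truncEulerSum_cons_succ, truncEulerSum_cons_succ (1, y)]
    have hr : ∑ p ∈ Finset.Icc 1 N, eulerTerm (1, y * z) (N + 1 - p)
        = ∑ p ∈ Finset.Icc 1 N, eulerTerm (1, y * z) p :=
      Finset.sum_nbij' (fun p => N + 1 - p) (fun p => N + 1 - p)
        (by simp only [Finset.mem_Icc]; omega) (by simp only [Finset.mem_Icc]; omega)
        (by simp only [Finset.mem_Icc]; omega) (by simp only [Finset.mem_Icc]; omega)
        (fun _ _ => rfl)
    rw [hr, truncEulerSum_singleton]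
    ring

/-! ### The restricted sum of truncated sums -/

theorem restrictedSum_add_one (u : ℕ) (F : ℕ → ℕ → ℝ) :
    restrictedSum (u + 1) F = ∑ i ∈ Finset.range (u - 1), F (i + 2) (u - 1 - i) := by
  refine Finset.sum_nbij' (fun p => p.1 - 2) (fun i => (i + 2, u - 1 - i)) ?_ ?_ ?_ ?_ ?_
  · simp only [Finset.mem_filter, Finset.HasAntidiagonal.mem_antidiagonal, Finset.mem_range]; omega
  · simp only [Finset.mem_filter, Finset.HasAntidiagonal.mem_antidiagonal, Finset.mem_range]; omega
  · simp only [Finset.mem_filter, Finset.HasAntidiagonal.mem_antidiagonal, Prod.ext_iff]; omega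
  · simp
  · simp only [Finset.mem_filter, Finset.HasAntidiagonal.mem_antidiagonal]
    rintro ⟨a, b⟩ ⟨h1, h2, h3⟩
    simp only at *
    congr 1 <;> omega

theorem restrictedSum_inv_pow_mul_inv_pow {u : ℕ} (hu : 2 ≤ u) {x y : ℝ} (hx : x ≠ 0) (hy : y ≠ 0)
    (hxy : x - y ≠ 0) :
    restrictedSum (u + 1) (fun a b => 1 / x ^ a * (1 / y ^ b))
      = 1 / y ^ u * (1 / (x - y) - 1 / x) - 1 / x ^ u * (1 / (x - y)) := by
  obtain ⟨k, rfl⟩ := Nat.exists_eq_add_of_le' hu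
  rw [restrictedSum_add_one]
  have h := Commute.geom_sum₂_mul (Commute.all (1 / x) (1 / y)) (k + 1)
  -- Since `a ≥ 2` and `b ≥ 1`, the factor `(1 / x) ^ 2 * (1 / y)` comes out and leaves a full
  -- geometric sum.
  have h1 : ∑ i ∈ Finset.range (k + 2 - 1), 1 / x ^ (i + 2) * (1 / y ^ (k + 2 - 1 - i))
      = (1 / x) ^ 2 * (1 / y)
        * ∑ i ∈ Finset.range (k + 1), (1 / x) ^ i * (1 / y) ^ (k + 1 - 1 - i) := by
    rw [Finset.mul_sum]
    refine Finset.sum_congr rfl fun i hi => ?_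
    have : k + 2 - 1 - i = (k + 1 - 1 - i) + 1 := by
      have := Finset.mem_range.1 hi
      omega
    rw [this, ← one_div_pow, ← one_div_pow]
    ring
  rw [h1]
  have h2 : 1 / x - 1 / y = -((x - y) / (x * y)) := by field_simp; ring
  rw [h2] at h
  have h3 : ∑ i ∈ Finset.range (k + 1), (1 / x) ^ i * (1 / y) ^ (k + 1 - 1 - i)
      = ((1 / y) ^ (k + 1) - (1 / x) ^ (k + 1)) * (x * y) / (x - y) := by
    field_simp at h ⊢
    linear_combination -h
  rw [h3]
  simp only [one_div_pow]
  field_simp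
  ring

/-- Interchanging the two outer summations in the part with denominator `n - m`. -/
theorem sum_pow_mul_sum_div_sub (α : ℤˣ) (g : ℕ → ℝ) (M : ℕ) :
    ∑ n ∈ Finset.Icc 1 M, ((α : ℤ) : ℝ) ^ n
        * ∑ m ∈ Finset.Icc 1 (n - 1), g m * (1 / ((n : ℝ) - m))
      = ∑ m ∈ Finset.Icc 1 M, ((α : ℤ) : ℝ) ^ m * g m * truncEulerSum [(1, α)] (M - m) := by
  induction M with
  | zero => simp
  | succ M ih =>
    rw [Finset.sum_Icc_succ_top (by omega), ih, Finset.sum_Icc_succ_top (by omega), Nat.sub_self,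
      truncEulerSum_cons_zero, mul_zero, add_zero, Nat.add_sub_cancel, Finset.mul_sum,
      ← Finset.sum_add_distrib]
    refine Finset.sum_congr rfl fun m hm => ?_
    obtain ⟨-, hm⟩ := Finset.mem_Icc.1 hm
    have hs := sign_pow_sub α (show m ≤ M + 1 by omega)
    have hc : ((M + 1 - m : ℕ) : ℝ) = ((M + 1 : ℕ) : ℝ) - m := Nat.cast_sub (by omega)
    have ha : ((α : ℤ) : ℝ) ^ m * ((α : ℤ) : ℝ) ^ m = 1 := by
      rw [← mul_pow, units_cast_mul_self, one_pow]
    rw [show M + 1 - m = M - m + 1 by omega] at hs hc ⊢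
    rw [truncEulerSum_cons_succ, truncEulerSum_nil, eulerTerm, hs, hc, pow_one]
    linear_combination (-((α : ℤ) : ℝ) ^ (M + 1) * g m / (((M + 1 : ℕ) : ℝ) - m)) * ha

/-- The substitution `p = n - m` turns the inner sum into the convolution of the shuffle product. -/
theorem sum_eulerTerm_mul_sum_div_sub (u : ℕ) (α β γ : ℤˣ) (M : ℕ) :
    ∑ n ∈ Finset.Icc 1 M, eulerTerm (u, α) n * ∑ m ∈ Finset.Icc 1 (n - 1),
        ((β : ℤ) : ℝ) ^ m * truncEulerSum [(1, γ)] (m - 1) * (1 / ((n : ℝ) - m))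
      = truncEulerSum [(u, α * β), (1, γ), (1, β * γ)] M
        + truncEulerSum [(u, α * β), (1, β), (1, β * γ)] M := by
  rw [truncEulerSum_cons, truncEulerSum_cons, ← Finset.sum_add_distrib]
  refine Finset.sum_congr rfl fun n hn => ?_
  have hn := (Finset.mem_Icc.1 hn).1
  rw [← mul_add, ← sum_eulerTerm_mul_truncEulerSum_sub]
  have hr : ∑ m ∈ Finset.Icc 1 (n - 1),
        ((β : ℤ) : ℝ) ^ m * truncEulerSum [(1, γ)] (m - 1) * (1 / ((n : ℝ) - m))
      = ((β : ℤ) : ℝ) ^ n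
        * ∑ p ∈ Finset.Icc 1 (n - 1), eulerTerm (1, β) p
          * truncEulerSum [(1, γ)] (n - 1 - p) := by
    rw [Finset.mul_sum]
    refine Finset.sum_nbij' (fun p => n - p) (fun p => n - p)
        (by simp only [Finset.mem_Icc]; omega) (by simp only [Finset.mem_Icc]; omega)
        (by simp only [Finset.mem_Icc]; omega) (by simp only [Finset.mem_Icc]; omega)
        fun m hm => ?_
    obtain ⟨hm1, hm2⟩ := Finset.mem_Icc.1 hm
    have hmn : m ≤ n := by omega
    have hb : ((β : ℤ) : ℝ) ^ n * ((β : ℤ) : ℝ) ^ n = 1 := by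
      rw [← mul_pow, units_cast_mul_self, one_pow]
    rw [eulerTerm, show n - 1 - (n - m) = m - 1 by omega, sign_pow_sub β hmn, Nat.cast_sub hmn,
      pow_one]
    linear_combination (-((β : ℤ) : ℝ) ^ m * truncEulerSum [(1, γ)] (m - 1) / ((n : ℝ) - m)) * hb
  rw [hr]
  simp only [eulerTerm, Units.val_mul, Int.cast_mul, mul_pow]
  ring

theorem restrictedSum_finset_sum (N : ℕ) {ι : Type*} (s : Finset ι) (F : ι → ℕ → ℕ → ℝ) :
    restrictedSum N (fun a b => ∑ i ∈ s, F i a b) = ∑ i ∈ s, restrictedSum N (F i) :=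
  Finset.sum_comm

theorem restrictedSum_mul_left (N : ℕ) (c : ℝ) (F : ℕ → ℕ → ℝ) :
    restrictedSum N (fun a b => c * F a b) = c * restrictedSum N F :=
  (Finset.mul_sum _ _ _).symm

theorem restrictedSum_truncEulerSum {u : ℕ} (hu : 2 ≤ u) (α β γ : ℤˣ) (M : ℕ) :
    restrictedSum (u + 1) (fun a b => truncEulerSum [(a, α), (b, β), (1, γ)] M)
      = ∑ m ∈ Finset.Icc 1 M, eulerTerm (u, α * β) m * truncEulerSum [(1, γ)] (m - 1)
          * truncEulerSum [(1, α)] (M - m)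
        - truncEulerSum [(1, α), (u, β), (1, γ)] M
        - (truncEulerSum [(u, α * β), (1, γ), (1, β * γ)] M
          + truncEulerSum [(u, α * β), (1, β), (1, β * γ)] M) := by
  have hX : ∑ m ∈ Finset.Icc 1 M, eulerTerm (u, α * β) m * truncEulerSum [(1, γ)] (m - 1)
          * truncEulerSum [(1, α)] (M - m)
      = ∑ n ∈ Finset.Icc 1 M, ((α : ℤ) : ℝ) ^ n * ∑ m ∈ Finset.Icc 1 (n - 1),
          eulerTerm (u, β) m * truncEulerSum [(1, γ)] (m - 1) * (1 / ((n : ℝ) - m)) := by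
    rw [sum_pow_mul_sum_div_sub]
    refine Finset.sum_congr rfl fun m _ => ?_
    simp only [eulerTerm, Units.val_mul, Int.cast_mul, mul_pow]
    ring
  rw [hX, ← sum_eulerTerm_mul_sum_div_sub, truncEulerSum_cons]
  simp only [truncEulerSum_cons (_, α) (_ :: _), truncEulerSum_cons (_, β), Finset.mul_sum]
  simp only [restrictedSum_finset_sum, ← Finset.sum_sub_distrib]
  refine Finset.sum_congr rfl fun n hn => Finset.sum_congr rfl fun m hm => ?_
  obtain ⟨hn1, -⟩ := Finset.mem_Icc.1 hn
  obtain ⟨hm1, hm2⟩ := Finset.mem_Icc.1 hm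
  have hn0 : (n : ℝ) ≠ 0 := by positivity
  have hm0 : (m : ℝ) ≠ 0 := by positivity
  have hnm : (n : ℝ) - m ≠ 0 := by
    rw [sub_ne_zero]
    exact_mod_cast (by omega : n ≠ m)
  have h := restrictedSum_inv_pow_mul_inv_pow hu hn0 hm0 hnm
  have hF : (fun a b => eulerTerm (a, α) n * (eulerTerm (b, β) m * truncEulerSum [(1, γ)] (m - 1)))
      = fun a b => ((α : ℤ) : ℝ) ^ n * ((β : ℤ) : ℝ) ^ m * truncEulerSum [(1, γ)] (m - 1)
        * (1 / (n : ℝ) ^ a * (1 / (m : ℝ) ^ b)) := by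
    funext a b
    simp only [eulerTerm]
    ring
  rw [hF, restrictedSum_mul_left, h]
  simp only [eulerTerm]
  ring

/-! ### The error term -/

/-- The bound is uniform in `N`, as domination requires: the `j`-th added term is at most `1 / (N +
j) ≤ 1 / j`. -/
theorem abs_truncEulerSum_add_sub_le (z : ℤˣ) (N m : ℕ) :
    |truncEulerSum [(1, z)] (N + m) - truncEulerSum [(1, z)] N| ≤ harmonic m := by
  induction m with
  | zero => simp
  | succ m ih =>
    rw [← add_assoc, truncEulerSum_cons_succ, truncEulerSum_nil, mul_one, add_sub_right_comm,
      harmonic_real_succ]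
    refine (abs_add_le _ _).trans (add_le_add ih ?_)
    rw [abs_eulerTerm, pow_one]
    exact one_div_le_one_div_of_le (by positivity) (by exact_mod_cast (by omega))

theorem tendsto_truncEulerSum_add_sub (z : ℤˣ) (m : ℕ) :
    Tendsto (fun N => truncEulerSum [(1, z)] (N + m) - truncEulerSum [(1, z)] N) atTop (𝓝 0) := by
  induction m with
  | zero => simp
  | succ m ih =>
    have h : Tendsto (fun N => eulerTerm (1, z) (N + (m + 1))) atTop (𝓝 0) := by
      refine (tendsto_add_atTop_iff_nat (m + 1)).2 (squeeze_zero_norm (fun n => ?_)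
        tendsto_one_div_atTop_nhds_zero_nat)
      rw [Real.norm_eq_abs, abs_eulerTerm, pow_one]
    have := ih.add h
    rw [add_zero] at this
    refine this.congr fun N => ?_
    rw [← add_assoc, truncEulerSum_cons_succ, truncEulerSum_nil]
    ring

theorem tendsto_sum_eulerTerm_mul_sub {u : ℕ} (hu : 2 ≤ u) (α δ γ : ℤˣ) :
    Tendsto (fun M => ∑ m ∈ Finset.Icc 1 M, eulerTerm (u, δ) m * truncEulerSum [(1, γ)] (m - 1)
      * (truncEulerSum [(1, α)] M - truncEulerSum [(1, α)] (M - m))) atTop (𝓝 0) := by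
  -- Extended by zero to all `m`, the terms are dominated by the harmonic number squared over the
  -- index squared.
  have key := tendsto_tsum_of_dominated_convergence (𝓕 := atTop)
    (f := fun M m => if m < M then eulerTerm (u, δ) (m + 1) * truncEulerSum [(1, γ)] m
      * (truncEulerSum [(1, α)] M - truncEulerSum [(1, α)] (M - (m + 1))) else 0)
    (g := fun _ => (0 : ℝ)) ((summable_nat_add_iff 1).2 (summable_harmonic_pow_div_sq 2)) ?_ ?_
  · rw [tsum_zero] at key
    refine key.congr fun M => ?_
    rw [sum_Icc_one_eq_sum_range, tsum_eq_sum (s := Finset.range M)]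
    · refine Finset.sum_congr rfl fun m hm => ?_
      rw [if_pos (Finset.mem_range.1 hm), Nat.add_sub_cancel]
    · intro m hm
      rw [if_neg (by simpa using hm)]
  · intro m
    have h := (tendsto_truncEulerSum_add_sub α (m + 1)).const_mul
      (eulerTerm (u, δ) (m + 1) * truncEulerSum [(1, γ)] m)
    rw [mul_zero] at h
    -- Put `M = N + (m + 1)`, so that the cutoff holds and the natural subtraction is exact.
    refine (tendsto_add_atTop_iff_nat (m + 1)).1 (h.congr fun N => ?_)
    rw [if_pos (by omega), Nat.add_sub_cancel]
  · refine Eventually.of_forall fun M m => ?_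
    split_ifs with hm
    · obtain ⟨k, rfl⟩ := Nat.exists_eq_add_of_lt hm
      rw [show m + k + 1 - (m + 1) = k by omega, show m + k + 1 = k + (m + 1) by omega,
        Real.norm_eq_abs, abs_mul, abs_mul]
      have h1 := abs_eulerTerm_le (u, δ) 2 hu m
      have h2 := (abs_truncEulerSum_le [(1, γ)] (by simp) m).trans
        (pow_le_pow_left₀ (harmonic_real_nonneg m) (harmonic_real_mono (Nat.le_succ m)) _)
      have h3 := abs_truncEulerSum_add_sub_le α k (m + 1)
      rw [List.length_singleton, pow_one] at h2
      calc _ ≤ 1 / ((m + 1 : ℕ) : ℝ) ^ 2 * harmonic (m + 1) * harmonic (m + 1) :=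
            mul_le_mul (mul_le_mul h1 h2 (abs_nonneg _) (by positivity)) h3 (abs_nonneg _)
              (mul_nonneg (by positivity) (harmonic_real_nonneg _))
        _ = _ := by ring
    · rw [norm_zero]
      exact div_nonneg (pow_nonneg (harmonic_real_nonneg _) _) (by positivity)

/-! ### The restricted sum formula -/

theorem restrictedSum_truncEulerSum_add_error {u : ℕ} (hu : 2 ≤ u) (α β γ : ℤˣ) (M : ℕ) :
    restrictedSum (u + 1) (fun a b => truncEulerSum [(a, α), (b, β), (1, γ)] M)
      = (truncEulerSum [(1, α), (u, α * β), (1, γ)] M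
          - truncEulerSum [(1, α), (u, β), (1, γ)] M)
        + truncEulerSum [(u + 1, β), (1, γ)] M
        + truncEulerSum [(u, α * β), (2, α * γ)] M
        + truncEulerSum [(u, α * β), (1, α), (1, γ)] M
        + truncEulerSum [(u, α * β), (1, γ), (1, α)] M
        - truncEulerSum [(u, α * β), (1, γ), (1, β * γ)] M
        - truncEulerSum [(u, α * β), (1, β), (1, β * γ)] M
        - ∑ m ∈ Finset.Icc 1 M, eulerTerm (u, α * β) m * truncEulerSum [(1, γ)] (m - 1)
          * (truncEulerSum [(1, α)] M - truncEulerSum [(1, α)] (M - m)) := by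
  have h := truncEulerSum_mul_depth_two (1, α) (u, α * β) (1, γ) M
  have hα : α * (α * β) = β := by
    rw [← mul_assoc, Int.units_mul_self, one_mul]
  simp only [hα, add_comm 1 u, one_add_one_eq_two] at h
  simp only [restrictedSum_truncEulerSum hu, mul_sub, Finset.sum_sub_distrib, ← Finset.sum_mul]
  rw [truncEulerSum_cons (u, α * β) [(1, γ)]] at h
  linear_combination h

/-- The limit `D` is assumed for the difference only, so that `α = 1` is covered. -/
theorem restrictedSum_eulerSum {u : ℕ} (hu : 2 ≤ u) (α β γ : ℤˣ) {D : ℝ}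
    (hD : Tendsto (fun M => truncEulerSum [(1, α), (u, α * β), (1, γ)] M
      - truncEulerSum [(1, α), (u, β), (1, γ)] M) atTop (𝓝 D)) :
    restrictedSum (u + 1) (fun a b => eulerSum [(a, α), (b, β), (1, γ)])
      = D + eulerSum [(u + 1, β), (1, γ)] + eulerSum [(u, α * β), (2, α * γ)]
        + eulerSum [(u, α * β), (1, α), (1, γ)] + eulerSum [(u, α * β), (1, γ), (1, α)]
        - eulerSum [(u, α * β), (1, γ), (1, β * γ)]
        - eulerSum [(u, α * β), (1, β), (1, β * γ)] := by
  have adm : ∀ (s : ℕ) (z : ℤˣ) (t : List (ℕ × ℤˣ)), 2 ≤ s → (∀ q ∈ t, 1 ≤ q.1) →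
      Tendsto (truncEulerSum ((s, z) :: t)) atTop (𝓝 (eulerSum ((s, z) :: t))) := by
    intro s z t hs ht
    refine tendsto_truncEulerSum ⟨?_, ?_⟩
    · simp only [plain, ne_eq, Prod.mk.injEq]
      omega
    · simp only [List.mem_cons, forall_eq_or_imp]
      exact ⟨by omega, ht⟩
  have hl : Tendsto (fun M => restrictedSum (u + 1)
      (fun a b => truncEulerSum [(a, α), (b, β), (1, γ)] M)) atTop
      (𝓝 (restrictedSum (u + 1) (fun a b => eulerSum [(a, α), (b, β), (1, γ)]))) := by
    refine tendsto_finsetSum _ fun p hp => ?_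
    obtain ⟨-, h2, h1⟩ := Finset.mem_filter.1 hp
    exact adm _ _ _ h2 (by simp [h1])
  have hr := (((((((hD.add (adm (u + 1) β [(1, γ)] (by omega) (by simp))).add
    (adm u (α * β) [(2, α * γ)] hu (by simp))).add
    (adm u (α * β) [(1, α), (1, γ)] hu (by simp))).add
    (adm u (α * β) [(1, γ), (1, α)] hu (by simp))).sub
    (adm u (α * β) [(1, γ), (1, β * γ)] hu (by simp))).sub
    (adm u (α * β) [(1, β), (1, β * γ)] hu (by simp))).sub
    (tendsto_sum_eulerTerm_mul_sub hu α (α * β) γ))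
  rw [sub_zero] at hr
  refine tendsto_nhds_unique hl (hr.congr fun M => ?_)
  rw [restrictedSum_truncEulerSum_add_error hu]

theorem restrictedSum_eulerSum_plain {u : ℕ} (hu : 2 ≤ u) (β γ : ℤˣ) :
    restrictedSum (u + 1) (fun a b => eulerSum [plain a, (b, β), (1, γ)])
      = eulerSum [(u + 1, β), (1, γ)] + eulerSum [(u, β), (2, γ)]
        + eulerSum [(u, β), plain 1, (1, γ)] + eulerSum [(u, β), (1, γ), plain 1]
        - eulerSum [(u, β), (1, γ), (1, β * γ)] - eulerSum [(u, β), (1, β), (1, β * γ)] := by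
  -- For `α = 1` the two possibly divergent sums coincide, hence `D = 0`.
  have h := restrictedSum_eulerSum hu 1 β γ (D := 0) (by simp)
  simpa only [one_mul, zero_add] using h

theorem restrictedSum_eulerSum_bar {u : ℕ} (hu : 2 ≤ u) (β γ : ℤˣ) :
    restrictedSum (u + 1) (fun a b => eulerSum [bar a, (b, β), (1, γ)])
      = eulerSum [bar 1, (u, -β), (1, γ)] - eulerSum [bar 1, (u, β), (1, γ)]
        + eulerSum [(u + 1, β), (1, γ)] + eulerSum [(u, -β), (2, -γ)]
        + eulerSum [(u, -β), bar 1, (1, γ)] + eulerSum [(u, -β), (1, γ), bar 1]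
        - eulerSum [(u, -β), (1, γ), (1, β * γ)] - eulerSum [(u, -β), (1, β), (1, β * γ)] := by
  have adm : ∀ δ : ℤˣ, AdmissibleIndex [bar 1, (u, δ), (1, γ)] := by
    intro δ
    refine ⟨by simp only [ne_eq, Prod.mk.injEq, true_and]; decide, ?_⟩
    simp only [List.mem_cons, forall_eq_or_imp]
    exact ⟨le_rfl, by omega, le_rfl, by simp⟩
  have h := restrictedSum_eulerSum hu (-1) β γ
    ((tendsto_truncEulerSum (adm (-1 * β))).sub (tendsto_truncEulerSum (adm β)))
  simpa only [neg_mul, one_mul] using h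

theorem mainTheorem9 :
    (∀ l : List (ℕ × ℤˣ), AdmissibleIndex l →
      Filter.Tendsto (truncEulerSum l) Filter.atTop (nhds (eulerSum l))) ∧
    ∀ w u v : ℕ, 4 ≤ w → u = w - 2 → v = w - 1 →
      (restrictedSum (w - 1) (fun a b => eulerSum [plain a, plain b, plain 1])
        = eulerSum [plain v, plain 1] + eulerSum [plain u, plain 2]) ∧
      (restrictedSum (w - 1) (fun a b => eulerSum [plain a, bar b, plain 1])
        = eulerSum [bar v, plain 1] + eulerSum [bar u, plain 2]
          + 2 * eulerSum [bar u, plain 1, plain 1]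
          - eulerSum [bar u, bar 1, bar 1] - eulerSum [bar u, plain 1, bar 1]) ∧
      (restrictedSum (w - 1) (fun a b => eulerSum [bar a, plain b, plain 1])
        = eulerSum [plain v, plain 1] + eulerSum [bar u, bar 2]
          + eulerSum [bar u, plain 1, bar 1] + eulerSum [bar u, bar 1, plain 1]
          + eulerSum [bar 1, bar u, plain 1]
          - 2 * eulerSum [bar u, plain 1, plain 1] - eulerSum [bar 1, plain u, plain 1]) ∧
      (restrictedSum (w - 1) (fun a b => eulerSum [bar a, bar b, plain 1])
        = eulerSum [bar v, plain 1] + eulerSum [plain u, bar 2]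
          + eulerSum [plain u, bar 1, plain 1] + eulerSum [bar 1, plain u, plain 1]
          - eulerSum [plain u, bar 1, bar 1] - eulerSum [bar 1, bar u, plain 1]) ∧
      (restrictedSum (w - 1) (fun a b => eulerSum [bar a, bar b, bar 1])
        = eulerSum [bar v, bar 1] + eulerSum [plain u, plain 2]
          + 2 * eulerSum [plain u, bar 1, bar 1] + eulerSum [bar 1, plain u, bar 1]
          - 2 * eulerSum [plain u, bar 1, plain 1] - eulerSum [bar 1, bar u, bar 1]) ∧
      (restrictedSum (w - 1) (fun a b => eulerSum [plain a, plain b, bar 1])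
        = eulerSum [plain v, bar 1] + eulerSum [plain u, bar 2]
          + eulerSum [plain u, bar 1, plain 1] - eulerSum [plain u, bar 1, bar 1]) ∧
      (restrictedSum (w - 1) (fun a b => eulerSum [plain a, bar b, bar 1])
        = eulerSum [bar v, bar 1] + eulerSum [bar u, bar 2]
          + eulerSum [bar u, plain 1, bar 1] - eulerSum [bar u, bar 1, plain 1]) ∧
      (restrictedSum (w - 1) (fun a b => eulerSum [bar a, plain b, bar 1])
        = eulerSum [plain v, bar 1] + eulerSum [bar u, plain 2]
          + eulerSum [bar u, bar 1, bar 1] + eulerSum [bar 1, bar u, bar 1]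
          - eulerSum [bar u, plain 1, bar 1] - eulerSum [bar 1, plain u, bar 1]) := by
  refine ⟨fun l hl => tendsto_truncEulerSum hl, ?_⟩
  rintro w u v hw rfl rfl
  obtain ⟨u, rfl⟩ := Nat.exists_eq_add_of_le' (show 2 ≤ w by omega)
  have hu : 2 ≤ u := by omega
  have hP := restrictedSum_eulerSum_plain hu
  have hB := restrictedSum_eulerSum_bar hu
  rw [show u + 2 - 1 = u + 1 by omega, show u + 2 - 2 = u by omega]
  refine ⟨?_, ?_, ?_, ?_, ?_, ?_, ?_, ?_⟩
  -- With all signs trivial the four depth-three sums cancel.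
  · have h := hP 1 1
    simp only [mul_one] at h
    linarith
  · have h := hP (-1) 1
    simp only [mul_one] at h
    linarith
  · have h := hB 1 1
    simp only [mul_one] at h
    linarith
  · have h := hB (-1) 1
    simp only [mul_one, neg_neg] at h
    linarith
  · have h := hB (-1) (-1)
    simp only [mul_neg, mul_one, neg_neg] at h
    linarith
  · have h := hP 1 (-1)
    simp only [one_mul] at h
    linarith
  · have h := hP (-1) (-1)
    simp only [mul_neg, mul_one, neg_neg] at h
    linarith
  · have h := hB 1 (-1)
    simp only [one_mul, neg_neg] at h
    linarith
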